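/- Let $[1,\alpha]$ denote an ordinal interval with its order topology, and put \[ H_1=\{f\in C([1,\omega\cdot 2],\mathbb R): f(\omega\cdot 2)=0\},\qquad H_2=C([1,\omega],\mathbb R), \] with the supremum norms. Definitions. All Banach spaces are real and nonzero. Let $K$ be a compact Hausdorff space, $E$ a Banach space, and $H$ a nonzero closed subspace of $C(K,E)$. Let $A\subseteq C(K,\mathbb R)$ be the closed linear span of $\{e^*\circ h: e^*\in E^*, h\in H\}$, and let $A^E$ be the set of those $a\in A$ for which $x\mapsto a(x)e$ belongs to $H$ for every $e\in E$ (if $E=\mathbb R$, then $A=A^E=H$). The Choquet boundary $\operatorname{Ch}_H K$ is the set of those $x\in K$ for which $h\mapsto h(x)$ is an extreme point of the closed unit ball of $A^*$. A point $x\in K$ is a weak peak point with respect to $H$ if for every neighbourhood $U$ of $x$ and every $\varepsilon\in(0,1)$ there is $h\in A^E$ with $0\le h\le 1$, $h(x)>1-\varepsilon$ and $h<\varepsilon$ on $\operatorname{Ch}_H K\setminus U$. The Banach-Mazur distance $d_{BM}(X,Y)$ is the infimum of $\|T\|\,\|T^{-1}\|$ over all surjective linear isomorphisms $T:X\to Y$.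 Then the Choquet boundaries of $H_1$ and $H_2$ are countable and consist of weak peak points, and $d_{BM}(H_1,H_2)=2$. Moreover, the Choquet boundary of $H_2$ is closed, that of $H_1$ is not closed, and the two are not homeomorphic. Consequently, the following theorem fails if the word "closed$^\dagger$" is omitted, and $H_1,H_2$ (with $E_1=E_2=\mathbb R$) is a counterexample. For $i=1,2$, let $K_i$ be a compact Hausdorff space, $E_i$ a Banach space containing no isomorphic copy of $c_0$, and $H_i$ a closed subspace of $C(K_i,E_i)$ such that $\operatorname{Ch}_{H_i}K_i$ is closed$^\dagger$, countable, and consists of weak peak points; suppose that for all natural numbers $m<n$ the space $E_1^m$ contains no isomorphic copy of $E_2^n$ and $E_2^m$ contains no isomorphic copy of $E_1^n$. If there is a surjective isomorphism $T:H_1\to H_2$ with $\|T\|\,\|T^{-1}\|<3$, then $\operatorname{Ch}_{H_1}K_1$ is homeomorphic to $\operatorname{Ch}_{H_2}K_2$. -/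

import Mathlib

set_option maxSynthPendingDepth 3

open Set Topology
open scoped ENNReal ZeroAtInfty

noncomputable section

/-- The canonical scalar function space `A` of a subspace `H` of `C(K, E)`: the closed linear span
of all functions `x ↦ φ (h x)` with `φ ∈ E*` and `h ∈ H`. -/
def canonicalScalar {K E : Type*} [TopologicalSpace K] [CompactSpace K]
    [NormedAddCommGroup E] [NormedSpace ℝ E] (H : Submodule ℝ C(K, E)) :
    Submodule ℝ C(K, ℝ) :=
  (Submodule.span ℝ {g : C(K, ℝ) | ∃ φ : E →L[ℝ] ℝ, ∃ h ∈ H, ∀ x, g x = φ (h x)}).topologicalClosure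

/-- The function `f ⊗ e : x ↦ f x • e`. -/
def tensorVec {K E : Type*} [TopologicalSpace K] [NormedAddCommGroup E] [NormedSpace ℝ E]
    (f : C(K, ℝ)) (e : E) : C(K, E) :=
  ⟨fun x => f x • e, by fun_prop⟩

/-- The set `A^E` of all `a ∈ A` such that `a ⊗ e ∈ H` for every `e ∈ E`. -/
def scalarMultipliers {K E : Type*} [TopologicalSpace K] [CompactSpace K]
    [NormedAddCommGroup E] [NormedSpace ℝ E] (H : Submodule ℝ C(K, E)) : Set C(K, ℝ) :=
  {a | a ∈ canonicalScalar H ∧ ∀ e : E, tensorVec a e ∈ H}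

/-- The evaluation functional `h ↦ h x` on a space `A` of scalar functions. -/
def evalOn {K : Type*} [TopologicalSpace K] [CompactSpace K] (A : Submodule ℝ C(K, ℝ)) (x : K) :
    A →L[ℝ] ℝ :=
  (ContinuousMap.evalCLM ℝ x).comp A.subtypeL

/-- The Choquet boundary of `H`: the points `x` whose evaluation functional is an extreme point
of the closed unit ball of `A*`, where `A` is the canonical scalar function space of `H`. -/
def choquetBoundary {K E : Type*} [TopologicalSpace K] [CompactSpace K]
    [NormedAddCommGroup E] [NormedSpace ℝ E] (H : Submodule ℝ C(K, E)) : Set K :=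
  {x | evalOn (canonicalScalar H) x ∈
    extremePoints ℝ (Metric.closedBall (0 : canonicalScalar H →L[ℝ] ℝ) 1)}

/-- Weak peak points with respect to `H`. -/
def IsWeakPeakPoint {K E : Type*} [TopologicalSpace K] [CompactSpace K]
    [NormedAddCommGroup E] [NormedSpace ℝ E] (H : Submodule ℝ C(K, E)) (x : K) : Prop :=
  ∀ U ∈ 𝓝 x, ∀ ε ∈ Ioo (0 : ℝ) 1, ∃ h ∈ scalarMultipliers H,
    (∀ y, 0 ≤ h y ∧ h y ≤ 1) ∧ 1 - ε < h x ∧ ∀ y ∈ choquetBoundary H \ U, h y < ε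

/-- The Banach-Mazur distance: the infimum of `‖T‖ ‖T⁻¹‖` over all surjective isomorphisms
`T : X → Y` (it is `∞` when there are none). -/
def banachMazurDist (X Y : Type*) [NormedAddCommGroup X] [NormedSpace ℝ X]
    [NormedAddCommGroup Y] [NormedSpace ℝ Y] : ℝ≥0∞ :=
  ⨅ T : X ≃L[ℝ] Y, ENNReal.ofReal (‖(T : X →L[ℝ] Y)‖ * ‖(T.symm : Y →L[ℝ] X)‖)

/-- `X` contains an isomorphic copy of `Y`. -/
def ContainsCopy (X Y : Type*) [NormedAddCommGroup X] [NormedSpace ℝ X]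
    [NormedAddCommGroup Y] [NormedSpace ℝ Y] : Prop :=
  ∃ S : Submodule ℝ X, Nonempty (Y ≃L[ℝ] S)

/-- All hypotheses of the Amir-Cambern type theorem with constant `3` for function spaces with
countable boundaries, EXCEPT the closedness of the two Choquet boundaries: `E₁`, `E₂` are nonzero
and contain no copy of `c₀`; for `m < n`, no `E₁ ^ m` contains a copy of `E₂ ^ n` and vice versa;
`H₁`, `H₂` are nonzero closed subspaces whose Choquet boundaries are countable and consist of weak
peak points; and there is a surjective isomorphism `T : H₁ → H₂` with `‖T‖ ‖T⁻¹‖ < 3`. -/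
def RigidityHypotheses {K₁ K₂ E₁ E₂ : Type*}
    [TopologicalSpace K₁] [CompactSpace K₁] [TopologicalSpace K₂] [CompactSpace K₂]
    [NormedAddCommGroup E₁] [NormedSpace ℝ E₁] [NormedAddCommGroup E₂] [NormedSpace ℝ E₂]
    (H₁ : Submodule ℝ C(K₁, E₁)) (H₂ : Submodule ℝ C(K₂, E₂)) : Prop :=
  Nontrivial E₁ ∧ Nontrivial E₂ ∧
  ¬ ContainsCopy E₁ C₀(ℕ, ℝ) ∧ ¬ ContainsCopy E₂ C₀(ℕ, ℝ) ∧
  (∀ m n : ℕ, m < n →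
    ¬ ContainsCopy (Fin m → E₁) (Fin n → E₂) ∧ ¬ ContainsCopy (Fin m → E₂) (Fin n → E₁)) ∧
  Nontrivial H₁ ∧ Nontrivial H₂ ∧
  IsClosed (H₁ : Set C(K₁, E₁)) ∧ IsClosed (H₂ : Set C(K₂, E₂)) ∧
  (choquetBoundary H₁).Countable ∧ (choquetBoundary H₂).Countable ∧
  (∀ x ∈ choquetBoundary H₁, IsWeakPeakPoint H₁ x) ∧
  (∀ x ∈ choquetBoundary H₂, IsWeakPeakPoint H₂ x) ∧
  ∃ T : H₁ ≃L[ℝ] H₂, ‖(T : H₁ →L[ℝ] H₂)‖ * ‖(T.symm : H₂ →L[ℝ] H₁)‖ < 3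

/-- The ordinal interval `[1, α]`, with the order topology. -/
abbrev OrdinalInterval (α : Ordinal.{0}) : Type 1 := Icc (1 : Ordinal.{0}) α

theorem one_le_omega0_mul_two : (1 : Ordinal.{0}) ≤ Ordinal.omega0 * 2 := by
  rw [Order.one_le_iff_pos]
  exact mul_pos Ordinal.omega0_pos two_pos

/-- The space of all `f ∈ C([1, ω·2])` with `f (ω·2) = 0`. -/
def exampleH₁ : Submodule ℝ C(OrdinalInterval (Ordinal.omega0 * 2), ℝ) where
  carrier := {f | f ⟨Ordinal.omega0 * 2, one_le_omega0_mul_two, le_rfl⟩ = 0}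
  zero_mem' := by simp
  add_mem' := by
    intro f g hf hg
    simp only [mem_ofPred_eq] at hf hg
    simp [hf, hg]
  smul_mem' := by
    intro c f hf
    simp only [mem_ofPred_eq] at hf
    simp [hf]

/-- The space `C([1, ω])`. -/
def exampleH₂ : Submodule ℝ C(OrdinalInterval Ordinal.omega0, ℝ) := ⊤

end

open Filter

/-! ### Enumeration of the ordinal intervals `[1, ω]` and `[1, ω·2]` -/

/-! The space `[1, ω·2]` is two convergent sequences, and vanishing at `ω·2` makes the second half
of `f` a null sequence; so `H₁` is `C([1, ω]) ⊕ c₀` with the max norm.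

Every point other than `ω·2` has a basis of clopen neighbourhoods whose indicators lie in the space.
This makes it both a weak peak point and a Choquet point, while evaluation at `ω·2` is zero on `H₁`.
Hence the boundary of `H₁` is `[1, ω·2)`, which is not compact, and that of `H₂` is the compact
space `[1, ω]`.

Upper bound 2 (`interleaveLinearEquiv`): send a pair `(a, b)` to the sequence of the `a k + b k` and
`a k - b k`. It converges because `b` is null; the norm is at most 2, and the inverse, by half sums
and half differences, has norm at most 1.

Lower bound 2 (`two_le_norm_mul_norm_symm`): each element of `H₁` has a nearly disjoint unit vector
(`exists_norm_add_smul_le`), whereas in `C(K)` nothing is disjoint from the constant `1`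
(`one_add_norm_le_max`). An isomorphism must bridge this gap at the preimage of `1`.

Since 2 < 3, the pair refutes the rigidity theorem without closedness. -/

theorem omega0_mul_two : Ordinal.omega0.{0} * 2 = Ordinal.omega0 + Ordinal.omega0 := by
  rw [← one_add_one_eq_two, mul_add, mul_one]

theorem ordinal_tendsto_add_nat (γ : Ordinal.{0}) :
    Tendsto (fun n : ℕ => γ + ((n + 1 : ℕ) : Ordinal.{0})) atTop (𝓝 (γ + Ordinal.omega0)) := by
  rw [tendsto_order]
  refine ⟨fun a ha => ?_, fun a ha => Eventually.of_forall fun n => lt_trans ?_ ha⟩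
  · obtain ⟨d, hd, had⟩ := (Ordinal.lt_add_iff Ordinal.omega0_ne_zero).1 ha
    obtain ⟨m, rfl⟩ := Ordinal.lt_omega0.1 hd
    filter_upwards [eventually_ge_atTop m] with n hn
    refine had.trans_lt ((add_lt_add_iff_left γ).2 ?_)
    exact_mod_cast Nat.lt_succ_of_le hn
  · exact (add_lt_add_iff_left γ).2 (Ordinal.natCast_lt_omega0 _)

/-- The convergent sequence `γ + 1, γ + 2, …` with limit `γ + ω`, inside `[1, α]`. -/
noncomputable def ordinalSeq (γ α : Ordinal.{0}) (h : γ + Ordinal.omega0 ≤ α) :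
    C(OnePoint ℕ, OrdinalInterval α) :=
  OnePoint.continuousMapMkNat
    (fun n => ⟨γ + ((n + 1 : ℕ) : Ordinal.{0}),
      le_trans (by exact_mod_cast Nat.succ_pos n) le_add_self,
      le_trans (add_le_add_right (Ordinal.natCast_lt_omega0 _).le γ) h⟩)
    ⟨γ + Ordinal.omega0, Ordinal.one_lt_omega0.le.trans le_add_self, h⟩
    (tendsto_subtype_rng.2 (ordinal_tendsto_add_nat γ))

theorem ordinalSeq_coe (γ α : Ordinal.{0}) (h : γ + Ordinal.omega0 ≤ α) (n : ℕ) :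
    (ordinalSeq γ α h (n : OnePoint ℕ) : Ordinal) = γ + ((n + 1 : ℕ) : Ordinal.{0}) := rfl

theorem ordinalSeq_infty (γ α : Ordinal.{0}) (h : γ + Ordinal.omega0 ≤ α) :
    (ordinalSeq γ α h OnePoint.infty : Ordinal) = γ + Ordinal.omega0 := rfl

theorem lt_ordinalSeq (γ α : Ordinal.{0}) (h : γ + Ordinal.omega0 ≤ α) (p : OnePoint ℕ) :
    γ < ordinalSeq γ α h p := by
  induction p using OnePoint.rec with
  | infty => rw [ordinalSeq_infty]; exact lt_add_of_pos_right _ Ordinal.omega0_pos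
  | coe n =>
    rw [ordinalSeq_coe]
    exact lt_add_of_pos_right _ (by exact_mod_cast Nat.succ_pos n)

theorem ordinalSeq_le (γ α : Ordinal.{0}) (h : γ + Ordinal.omega0 ≤ α) (p : OnePoint ℕ) :
    (ordinalSeq γ α h p : Ordinal) ≤ γ + Ordinal.omega0 := by
  induction p using OnePoint.rec with
  | infty => rw [ordinalSeq_infty]
  | coe n =>
    rw [ordinalSeq_coe]
    exact add_le_add_right (Ordinal.natCast_lt_omega0 _).le γ

theorem ordinalSeq_injective (γ α : Ordinal.{0}) (h : γ + Ordinal.omega0 ≤ α) :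
    Function.Injective (ordinalSeq γ α h) := by
  intro p q hpq
  replace hpq := congrArg Subtype.val hpq
  induction p using OnePoint.rec with
  | infty =>
    induction q using OnePoint.rec with
    | infty => rfl
    | coe n =>
      rw [ordinalSeq_coe, ordinalSeq_infty, add_right_inj] at hpq
      exact absurd hpq.symm (Ordinal.natCast_lt_omega0 _).ne
  | coe m =>
    induction q using OnePoint.rec with
    | infty =>
      rw [ordinalSeq_coe, ordinalSeq_infty, add_right_inj] at hpq
      exact absurd hpq (Ordinal.natCast_lt_omega0 _).ne
    | coe n =>
      rw [ordinalSeq_coe, ordinalSeq_coe, add_right_inj, Nat.cast_inj, Nat.succ_inj] at hpq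
      rw [hpq]

theorem exists_ordinalSeq_eq (γ α : Ordinal.{0}) (h : γ + Ordinal.omega0 ≤ α)
    (x : OrdinalInterval α) (h₁ : γ < x) (h₂ : (x : Ordinal) ≤ γ + Ordinal.omega0) :
    ∃ p, ordinalSeq γ α h p = x := by
  obtain ⟨d, hd⟩ := exists_add_of_le h₁.le
  rw [hd] at h₁ h₂
  have hd₁ : 0 < d := pos_of_lt_add_right h₁
  have hd₂ : d ≤ Ordinal.omega0 := (add_le_add_iff_left γ).1 h₂
  rcases hd₂.eq_or_lt with rfl | hlt
  · exact ⟨OnePoint.infty, Subtype.ext hd.symm⟩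
  · obtain ⟨n, rfl⟩ := Ordinal.lt_omega0.1 hlt
    -- The sequence starts at `γ + 1`, so the offset `n > 0` has index `n - 1`.
    obtain ⟨m, rfl⟩ := Nat.exists_eq_succ_of_ne_zero (n := n) (by rintro rfl; simp at hd₁)
    exact ⟨(m : OnePoint ℕ), Subtype.ext hd.symm⟩

/-- The homeomorphism of `ℕ ∪ {∞}` with `[1, ω]`. -/
noncomputable def omegaHomeo : OnePoint ℕ ≃ₜ OrdinalInterval Ordinal.omega0 :=
  Continuous.homeoOfEquivCompactToT2
    (f := Equiv.ofBijective (ordinalSeq 0 Ordinal.omega0 (zero_add _).le)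
      ⟨ordinalSeq_injective _ _ _, fun x => exists_ordinalSeq_eq _ _ _ x
        (zero_lt_one.trans_le x.2.1) (x.2.2.trans (zero_add _).ge)⟩)
    (ordinalSeq 0 Ordinal.omega0 (zero_add _).le).continuous

/-- The initial piece `1, 2, …, ω` of `[1, ω·2]`. -/
noncomputable def lowerSeq : C(OnePoint ℕ, OrdinalInterval (Ordinal.omega0 * 2)) :=
  ordinalSeq 0 _ (by rw [zero_add, omega0_mul_two]; exact le_add_self)

/-- The final piece `ω + 1, ω + 2, …, ω·2` of `[1, ω·2]`. -/
noncomputable def upperSeq : C(OnePoint ℕ, OrdinalInterval (Ordinal.omega0 * 2)) :=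
  ordinalSeq Ordinal.omega0 _ omega0_mul_two.ge

/-- The two pieces fill the disjoint intervals `(0, ω]` and `(ω, ω·2]`. -/
theorem lowerSeq_sumElim_upperSeq_bijective :
    Function.Bijective (Sum.elim lowerSeq upperSeq) := by
  refine ⟨(ordinalSeq_injective _ _ _).sumElim (ordinalSeq_injective _ _ _) fun p q hpq => ?_,
    fun x => ?_⟩
  · have h₁ := ordinalSeq_le 0 (Ordinal.omega0 * 2)
      (by rw [zero_add, omega0_mul_two]; exact le_add_self) p
    have h₂ := lt_ordinalSeq Ordinal.omega0 (Ordinal.omega0 * 2) omega0_mul_two.ge q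
    exact ((h₁.trans (zero_add _).le).trans_lt h₂).ne (congrArg Subtype.val hpq)
  · rcases le_or_gt (x : Ordinal) Ordinal.omega0 with hx | hx
    · obtain ⟨p, hp⟩ := exists_ordinalSeq_eq 0 (Ordinal.omega0 * 2)
        (by rw [zero_add, omega0_mul_two]; exact le_add_self) x
        (zero_lt_one.trans_le x.2.1) (hx.trans (zero_add _).ge)
      exact ⟨Sum.inl p, hp⟩
    · obtain ⟨p, hp⟩ := exists_ordinalSeq_eq Ordinal.omega0 (Ordinal.omega0 * 2)
        omega0_mul_two.ge x hx (x.2.2.trans omega0_mul_two.le)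
      exact ⟨Sum.inr p, hp⟩

/-- The homeomorphism of two disjoint copies of `ℕ ∪ {∞}` with `[1, ω·2]`. -/
noncomputable def omegaTwoHomeo :
    OnePoint ℕ ⊕ OnePoint ℕ ≃ₜ OrdinalInterval (Ordinal.omega0 * 2) :=
  Continuous.homeoOfEquivCompactToT2
    (f := Equiv.ofBijective (Sum.elim lowerSeq upperSeq) lowerSeq_sumElim_upperSeq_bijective)
    (lowerSeq.continuous.sumElim upperSeq.continuous)

/-- The last point of `[1, ω·2]`. -/
noncomputable def omegaTwoTop : OrdinalInterval (Ordinal.omega0 * 2) :=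
  ⟨Ordinal.omega0 * 2, one_le_omega0_mul_two, le_rfl⟩

theorem upperSeq_infty : upperSeq OnePoint.infty = omegaTwoTop := by
  apply Subtype.ext
  exact omega0_mul_two.symm

theorem mem_exampleH₁ {f : C(OrdinalInterval (Ordinal.omega0 * 2), ℝ)} :
    f ∈ exampleH₁ ↔ f omegaTwoTop = 0 := Iff.rfl

instance : Countable (OrdinalInterval Ordinal.omega0) :=
  have : Countable (OnePoint ℕ) := inferInstanceAs (Countable (Option ℕ))
  omegaHomeo.symm.injective.countable

instance : Countable (OrdinalInterval (Ordinal.omega0 * 2)) :=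
  have : Countable (OnePoint ℕ) := inferInstanceAs (Countable (Option ℕ))
  have : Countable (OnePoint ℕ ⊕ OnePoint ℕ) := inferInstance
  omegaTwoHomeo.symm.injective.countable

/-! ### Choquet boundaries -/

/-- A functional on `ℝ` is multiplication by its value at `1`, so composing with it stays in `H`. -/
theorem canonicalScalar_eq_self {K : Type*} [TopologicalSpace K] [CompactSpace K]
    {H : Submodule ℝ C(K, ℝ)} (hH : IsClosed (H : Set C(K, ℝ))) : canonicalScalar H = H := by
  apply le_antisymm
  · refine Submodule.topologicalClosure_minimal _ (Submodule.span_le.2 ?_) hH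
    rintro g ⟨φ, h, hh, hg⟩
    have : g = φ 1 • h := by
      ext x
      rw [hg x, ContinuousMap.smul_apply, smul_eq_mul, mul_comm, ← smul_eq_mul, ← map_smul,
        smul_eq_mul, mul_one]
    rw [this]
    exact H.smul_mem _ hh
  · intro h hh
    exact Submodule.le_topologicalClosure _
      (Submodule.subset_span ⟨ContinuousLinearMap.id ℝ ℝ, h, hh, fun x => rfl⟩)

/-- `H` contains functions into `[0, 1]` that peak at `x` and vanish off any given neighbourhood. -/
def HasIndicatorBasis {K : Type*} [TopologicalSpace K] (H : Submodule ℝ C(K, ℝ)) (x : K) : Prop :=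
  ∀ U ∈ 𝓝 x, ∃ h ∈ H, (∀ y, 0 ≤ h y ∧ h y ≤ 1) ∧ h x = 1 ∧ ∀ y ∉ U, h y = 0

theorem HasIndicatorBasis.isWeakPeakPoint {K : Type*} [TopologicalSpace K] [CompactSpace K]
    {H : Submodule ℝ C(K, ℝ)} (hH : IsClosed (H : Set C(K, ℝ))) {x : K}
    (hx : HasIndicatorBasis H x) : IsWeakPeakPoint H x := by
  intro U hU ε hε
  obtain ⟨h, hh, h01, h1, h0⟩ := hx U hU
  refine ⟨h, ⟨by rwa [canonicalScalar_eq_self hH], fun e => ?_⟩, h01, ?_, ?_⟩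
  · have : tensorVec h e = e • h := by
      ext y
      simp [tensorVec, mul_comm]
    rw [this]
    exact H.smul_mem _ hh
  · rw [h1]; linarith [hε.1]
  · intro y hy
    rw [h0 y hy.2]
    exact hε.1

theorem norm_evalOn_le {K : Type*} [TopologicalSpace K] [CompactSpace K]
    (A : Submodule ℝ C(K, ℝ)) (x : K) : ‖evalOn A x‖ ≤ 1 := by
  refine ContinuousLinearMap.opNorm_le_bound _ zero_le_one fun f => ?_
  rw [one_mul]
  exact (f : C(K, ℝ)).norm_coe_le_norm x

/-- A functional in the unit ball taking the value `1` at all elements peaking at `x` is the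
evaluation at `x`. -/
theorem eq_evalOn_of_indicator {K : Type*} [TopologicalSpace K] [CompactSpace K]
    {A : Submodule ℝ C(K, ℝ)} {x : K} (hx : HasIndicatorBasis A x) {μ : A →L[ℝ] ℝ}
    (hμ : ‖μ‖ ≤ 1)
    (hμ1 : ∀ g : A, (∀ y, 0 ≤ (g : C(K, ℝ)) y ∧ (g : C(K, ℝ)) y ≤ 1) →
      (g : C(K, ℝ)) x = 1 → μ g = 1) : μ = evalOn A x := by
  have key : ∀ f : A, (f : C(K, ℝ)) x = 0 → μ f ≤ 0 := by
    intro f hf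
    refine le_of_forall_pos_le_add fun ε hε => ?_
    have hU : {y | |(f : C(K, ℝ)) y| < ε} ∈ 𝓝 x := by
      refine (isOpen_lt (f : C(K, ℝ)).continuous.abs continuous_const).mem_nhds ?_
      simpa [hf] using hε
    obtain ⟨h, hh, h01, h1, h0⟩ := hx _ hU
    -- With `s = ‖f‖ + 1`, the sum `h + f / s` is almost in the unit ball: where `|f| < ε` the
    -- second term adds at most `ε / s`, and elsewhere `h = 0` and `|f| / s ≤ 1`. As `μ h = 1`, this
    -- leaves `μ f ≤ ε`. The `+ 1` keeps `s` positive when `f = 0`.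
    have hs : 0 < ‖f‖ + 1 := by positivity
    have hb : ‖(⟨h, hh⟩ + (‖f‖ + 1)⁻¹ • f : A)‖ ≤ 1 + (‖f‖ + 1)⁻¹ * ε := by
      refine (ContinuousMap.norm_le _ (by positivity)).2 fun y => ?_
      change |h y + (‖f‖ + 1)⁻¹ * (f : C(K, ℝ)) y| ≤ _
      refine (abs_add_le _ _).trans ?_
      rw [abs_mul, abs_of_pos (inv_pos.2 hs), abs_of_nonneg (h01 y).1]
      by_cases hy : |(f : C(K, ℝ)) y| < ε
      · have := mul_le_mul_of_nonneg_left hy.le (inv_pos.2 hs).le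
        linarith [(h01 y).2]
      · rw [h0 y hy]
        have h2 : |(f : C(K, ℝ)) y| ≤ ‖f‖ + 1 :=
          ((f : C(K, ℝ)).norm_coe_le_norm y).trans (le_add_of_nonneg_right zero_le_one)
        have := mul_le_mul_of_nonneg_left h2 (inv_pos.2 hs).le
        rw [inv_mul_cancel₀ hs.ne'] at this
        have : 0 ≤ (‖f‖ + 1)⁻¹ * ε := by positivity
        linarith
    have h2 : μ (⟨h, hh⟩ + (‖f‖ + 1)⁻¹ • f : A) ≤ 1 + (‖f‖ + 1)⁻¹ * ε :=
      (le_abs_self _).trans (((μ.le_of_opNorm_le hμ _).trans_eq (one_mul _)).trans hb)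
    rw [map_add, map_smul, hμ1 ⟨h, hh⟩ h01 h1, smul_eq_mul] at h2
    have h3 := le_of_mul_le_mul_left (le_of_add_le_add_left h2) (inv_pos.2 hs)
    linarith
  have key' : ∀ f : A, (f : C(K, ℝ)) x = 0 → μ f = 0 := by
    intro f hf
    refine le_antisymm (key f hf) ?_
    have := key (-f) (by simp [hf])
    rw [map_neg] at this
    linarith
  -- Subtracting `f x • g` reduces a general `f` to one vanishing at `x`.
  obtain ⟨g, hg, g01, g1, -⟩ := hx univ univ_mem
  ext f
  have h1 := key' (f - (f : C(K, ℝ)) x • ⟨g, hg⟩) (by simp [g1])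
  rw [map_sub, map_smul, hμ1 ⟨g, hg⟩ g01 g1, smul_eq_mul, mul_one, sub_eq_zero] at h1
  exact h1

/-- If evaluation at `x` is a proper convex combination of `μ` and `ν` in the ball, then on a
function peaking at `x` both values are at most 1 and average to 1, so both equal 1;
`eq_evalOn_of_indicator` then identifies `μ` and `ν`. -/
theorem HasIndicatorBasis.mem_choquetBoundary {K : Type*} [TopologicalSpace K] [CompactSpace K]
    {H : Submodule ℝ C(K, ℝ)} (hH : IsClosed (H : Set C(K, ℝ))) {x : K}
    (hx : HasIndicatorBasis H x) : x ∈ choquetBoundary H := by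
  unfold choquetBoundary
  rw [mem_ofPred_eq, canonicalScalar_eq_self hH, mem_extremePoints]
  refine ⟨by simpa using norm_evalOn_le H x, ?_⟩
  intro μ hμ ν hν hmem
  rw [mem_closedBall_zero_iff] at hμ hν
  obtain ⟨s, t, hs, ht, hst, heq⟩ := hmem
  have main : ∀ g : H, (∀ y, 0 ≤ (g : C(K, ℝ)) y ∧ (g : C(K, ℝ)) y ≤ 1) →
      (g : C(K, ℝ)) x = 1 → μ g = 1 ∧ ν g = 1 := by
    intro g g01 g1
    have hg : ‖g‖ ≤ 1 := (ContinuousMap.norm_le _ zero_le_one).2 fun y => by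
      exact (Real.norm_of_nonneg (g01 y).1).trans_le (g01 y).2
    have h1 : μ g ≤ 1 := (le_abs_self _).trans
      ((μ.le_of_opNorm_le hμ g).trans (by rwa [one_mul]))
    have h2 : ν g ≤ 1 := (le_abs_self _).trans
      ((ν.le_of_opNorm_le hν g).trans (by rwa [one_mul]))
    have h3 : s * μ g + t * ν g = 1 := by
      have := congrArg (fun φ : H →L[ℝ] ℝ => φ g) heq
      exact this.trans g1
    have := mul_le_mul_of_nonneg_left h1 hs.le
    have := mul_le_mul_of_nonneg_left h2 ht.le
    constructor
    · exact mul_left_cancel₀ hs.ne' (by linarith)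
    · exact mul_left_cancel₀ ht.ne' (by linarith)
  exact ⟨eq_evalOn_of_indicator hx hμ fun g a b => (main g a b).1,
    eq_evalOn_of_indicator hx hν fun g a b => (main g a b).2⟩

/-- The evaluation is the zero functional, the midpoint of `φ` and `-φ` for any norm-one `φ`, hence
not extreme. -/
theorem notMem_choquetBoundary_of_vanish {K : Type*} [TopologicalSpace K] [CompactSpace K]
    {H : Submodule ℝ C(K, ℝ)} (hH : IsClosed (H : Set C(K, ℝ))) [Nontrivial H] {x : K}
    (hx : ∀ h ∈ H, h x = 0) : x ∉ choquetBoundary H := by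
  unfold choquetBoundary
  rw [mem_ofPred_eq, canonicalScalar_eq_self hH, mem_extremePoints]
  rintro ⟨-, h⟩
  have h0 : evalOn H x = 0 := by
    ext f
    exact hx f f.2
  obtain ⟨f, hf⟩ := exists_ne (0 : H)
  obtain ⟨φ, hφ, hφf⟩ := exists_dual_vector ℝ f (norm_ne_zero_iff.2 hf)
  have := (h φ (by simp [hφ]) (-φ) (by simp [hφ])
    ⟨1 / 2, 1 / 2, by norm_num, by norm_num, by norm_num, by rw [h0]; simp⟩).1
  rw [h0] at this
  rw [this, norm_zero] at hφ
  exact zero_ne_one hφ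

/-- In an ordinal interval, points have clopen neighbourhoods `(b, x]`. -/
theorem exists_ordinalInterval_indicator {α : Ordinal.{0}} (x : OrdinalInterval α)
    {U : Set (OrdinalInterval α)} (hU : U ∈ 𝓝 x) :
    ∃ h : C(OrdinalInterval α, ℝ), (∀ y, 0 ≤ h y ∧ h y ≤ 1) ∧ h x = 1 ∧ (∀ y ∉ U, h y = 0) ∧
      ∀ y, x < y → h y = 0 := by
  obtain ⟨V, hV, hVU⟩ := mem_nhds_subtype _ _ _ |>.1 hU
  obtain ⟨b, hb, hbV⟩ := exists_Ioc_subset_of_mem_nhds hV ⟨0, zero_lt_one.trans_le x.2.1⟩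
  -- `(b, x]` equals both `[b + 1, x]` and `(b, x + 1)`.
  have hclopen : IsClopen (Ioc b (x : Ordinal)) := by
    refine ⟨?_, ?_⟩
    · rw [← Order.Icc_succ_left]
      exact isClosed_Icc
    · rw [← Order.Ioo_succ_right]
      exact isOpen_Ioo
  set W : Set (OrdinalInterval α) := (↑) ⁻¹' Ioc b (x : Ordinal) with hWdef
  have hW : IsClopen W := hclopen.preimage continuous_subtype_val
  have hWU : W ⊆ U := fun y hy => hVU (hbV hy)
  refine ⟨⟨W.indicator (fun _ => (1 : ℝ)), hW.continuous_indicator continuous_const⟩,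
    fun y => ?_, ?_, fun y hy => ?_, fun y hy => ?_⟩
  · by_cases hy : y ∈ W <;> simp [indicator, hy]
  · exact indicator_of_mem (s := W) ⟨hb, le_rfl⟩ (fun _ => (1 : ℝ))
  · exact indicator_of_notMem (fun hmem => hy (hWU hmem)) (fun _ => (1 : ℝ))
  · exact indicator_of_notMem (s := W)
      (fun hmem => not_le_of_gt hy hmem.2) (fun _ => (1 : ℝ))

theorem hasIndicatorBasis_exampleH₂ (x : OrdinalInterval Ordinal.omega0) :
    HasIndicatorBasis exampleH₂ x := by
  intro U hU
  obtain ⟨h, h01, h1, h0, -⟩ := exists_ordinalInterval_indicator x hU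
  exact ⟨h, Submodule.mem_top, h01, h1, h0⟩

theorem hasIndicatorBasis_exampleH₁ {x : OrdinalInterval (Ordinal.omega0 * 2)}
    (hx : x ≠ omegaTwoTop) : HasIndicatorBasis exampleH₁ x := by
  intro U hU
  obtain ⟨h, h01, h1, h0, h2⟩ := exists_ordinalInterval_indicator x hU
  exact ⟨h, h2 _ (lt_of_le_of_ne x.2.2 hx), h01, h1, h0⟩

theorem isClosed_exampleH₁ :
    IsClosed (exampleH₁ : Set C(OrdinalInterval (Ordinal.omega0 * 2), ℝ)) :=
  isClosed_eq (continuous_eval_const omegaTwoTop) continuous_const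

theorem isClosed_exampleH₂ :
    IsClosed (exampleH₂ : Set C(OrdinalInterval Ordinal.omega0, ℝ)) := isClosed_univ

theorem upperSeq_coe_ne_top (n : ℕ) : upperSeq (n : OnePoint ℕ) ≠ omegaTwoTop := by
  rw [← upperSeq_infty]
  exact fun h => OnePoint.coe_ne_infty n (ordinalSeq_injective _ _ omega0_mul_two.ge h)

instance : Nontrivial exampleH₁ := by
  obtain ⟨h, hh, -, h1, -⟩ := hasIndicatorBasis_exampleH₁ (upperSeq_coe_ne_top 0) univ univ_mem
  refine ⟨⟨h, hh⟩, 0, fun h0 => zero_ne_one (α := ℝ) ?_⟩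
  have h2 : h = 0 := congrArg Subtype.val h0
  rw [← h1, h2]
  rfl

instance : Nontrivial exampleH₂ := by
  obtain ⟨h, hh, -, h1, -⟩ := hasIndicatorBasis_exampleH₂ (omegaHomeo OnePoint.infty) univ univ_mem
  refine ⟨⟨h, hh⟩, 0, fun h0 => zero_ne_one (α := ℝ) ?_⟩
  have h2 : h = 0 := congrArg Subtype.val h0
  rw [← h1, h2]
  rfl

theorem choquetBoundary_exampleH₂ : choquetBoundary exampleH₂ = univ :=
  eq_univ_of_forall fun x => (hasIndicatorBasis_exampleH₂ x).mem_choquetBoundary isClosed_exampleH₂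

theorem choquetBoundary_exampleH₁ : choquetBoundary exampleH₁ = {omegaTwoTop}ᶜ := by
  ext x
  refine ⟨fun hx hxt => ?_, fun hx =>
    (hasIndicatorBasis_exampleH₁ hx).mem_choquetBoundary isClosed_exampleH₁⟩
  rw [mem_singleton_iff] at hxt
  subst hxt
  exact notMem_choquetBoundary_of_vanish isClosed_exampleH₁ (fun h hh => hh) hx

theorem tendsto_onePoint_apply {X : Type*} [TopologicalSpace X] (f : C(OnePoint ℕ, X)) :
    Tendsto (fun n : ℕ => f (n : OnePoint ℕ)) atTop (𝓝 (f OnePoint.infty)) := by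
  have := OnePoint.continuous_iff_from_nat f |>.1 f.continuous
  exact this

theorem not_isClosed_choquetBoundary_exampleH₁ : ¬ IsClosed (choquetBoundary exampleH₁) := by
  intro h
  rw [choquetBoundary_exampleH₁] at h
  have := h.mem_of_tendsto (tendsto_onePoint_apply upperSeq)
    (Eventually.of_forall upperSeq_coe_ne_top)
  exact this upperSeq_infty

/-- A homeomorphism would transport compactness from `[1, ω]`, making the boundary of `H₁` closed.
-/
theorem isEmpty_choquetBoundary_homeomorph :
    IsEmpty (choquetBoundary exampleH₁ ≃ₜ choquetBoundary exampleH₂) := by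
  refine ⟨fun e => not_isClosed_choquetBoundary_exampleH₁ ?_⟩
  have : CompactSpace (choquetBoundary exampleH₂) := by
    rw [choquetBoundary_exampleH₂]
    exact isCompact_iff_compactSpace.1 isCompact_univ
  have : CompactSpace (choquetBoundary exampleH₁) := e.symm.compactSpace
  exact (isCompact_iff_compactSpace.2 this).isClosed

/-! ### An isomorphism with distortion `2` -/

theorem upperSeq_tendsto_zero (f : exampleH₁) :
    Tendsto (fun n : ℕ => (f : C(OrdinalInterval (Ordinal.omega0 * 2), ℝ))
      (upperSeq (n : OnePoint ℕ))) atTop (𝓝 0) := by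
  have h := tendsto_onePoint_apply ((f : C(OrdinalInterval (Ordinal.omega0 * 2), ℝ)).comp upperSeq)
  have h0 : ((f : C(OrdinalInterval (Ordinal.omega0 * 2), ℝ)).comp upperSeq) OnePoint.infty = 0 := by
    rw [ContinuousMap.comp_apply, upperSeq_infty]
    exact f.2
  rwa [h0] at h

/-- The upper half tends to `f (ω·2) = 0`, so the alternating sign does not affect the limit. -/
theorem tendsto_interleave (f : exampleH₁) :
    Tendsto (fun n : ℕ => (f : C(OrdinalInterval (Ordinal.omega0 * 2), ℝ))
        (lowerSeq ((n / 2 : ℕ) : OnePoint ℕ)) +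
      (-1) ^ n * (f : C(OrdinalInterval (Ordinal.omega0 * 2), ℝ))
        (upperSeq ((n / 2 : ℕ) : OnePoint ℕ))) atTop
      (𝓝 ((f : C(OrdinalInterval (Ordinal.omega0 * 2), ℝ)) (lowerSeq OnePoint.infty))) := by
  have hdiv : Tendsto (fun n : ℕ => n / 2) atTop atTop := Nat.tendsto_div_const_atTop two_ne_zero
  have h1 := (tendsto_onePoint_apply
    ((f : C(OrdinalInterval (Ordinal.omega0 * 2), ℝ)).comp lowerSeq)).comp hdiv
  have h2 := ((upperSeq_tendsto_zero f).comp hdiv).abs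
  rw [abs_zero] at h2
  rw [← add_zero ((f : C(OrdinalInterval (Ordinal.omega0 * 2), ℝ)) (lowerSeq OnePoint.infty))]
  refine h1.add ((tendsto_zero_iff_abs_tendsto_zero _).2 (h2.congr fun n => ?_))
  simp [abs_mul]

/-- Interleaving of the sums and the differences of the two halves of `f`. -/
noncomputable def interleave (f : exampleH₁) : C(OrdinalInterval Ordinal.omega0, ℝ) :=
  (OnePoint.continuousMapMkNat _ _ (tendsto_interleave f)).comp omegaHomeo.symm

theorem interleave_coe (f : exampleH₁) (n : ℕ) :
    interleave f (omegaHomeo (n : OnePoint ℕ)) =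
      (f : C(OrdinalInterval (Ordinal.omega0 * 2), ℝ)) (lowerSeq ((n / 2 : ℕ) : OnePoint ℕ)) +
      (-1) ^ n * (f : C(OrdinalInterval (Ordinal.omega0 * 2), ℝ))
        (upperSeq ((n / 2 : ℕ) : OnePoint ℕ)) := by
  simp only [interleave, ContinuousMap.comp_apply, ContinuousMap.coe_coe,
    Homeomorph.symm_apply_apply]
  rfl

theorem interleave_infty (f : exampleH₁) :
    interleave f (omegaHomeo OnePoint.infty) =
      (f : C(OrdinalInterval (Ordinal.omega0 * 2), ℝ)) (lowerSeq OnePoint.infty) := by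
  simp only [interleave, ContinuousMap.comp_apply, ContinuousMap.coe_coe,
    Homeomorph.symm_apply_apply]
  rfl

theorem tendsto_omegaHomeo (g : C(OrdinalInterval Ordinal.omega0, ℝ)) {φ : ℕ → ℕ}
    (hφ : Tendsto φ atTop atTop) :
    Tendsto (fun n => g (omegaHomeo ((φ n : ℕ) : OnePoint ℕ))) atTop
      (𝓝 (g (omegaHomeo OnePoint.infty))) :=
  (tendsto_onePoint_apply (g.comp ⟨omegaHomeo, omegaHomeo.continuous⟩)).comp hφ

theorem tendsto_two_mul : Tendsto (fun n : ℕ => 2 * n) atTop atTop :=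
  tendsto_atTop_mono (fun n => (by omega : n ≤ 2 * n)) tendsto_id

theorem tendsto_two_mul_add_one : Tendsto (fun n : ℕ => 2 * n + 1) atTop atTop :=
  tendsto_atTop_mono (fun n => (by omega : n ≤ 2 * n + 1)) tendsto_id

theorem tendsto_halfSum (g : C(OrdinalInterval Ordinal.omega0, ℝ)) :
    Tendsto (fun n : ℕ => (g (omegaHomeo ((2 * n : ℕ) : OnePoint ℕ)) +
      g (omegaHomeo ((2 * n + 1 : ℕ) : OnePoint ℕ))) / 2) atTop
      (𝓝 (g (omegaHomeo OnePoint.infty))) := by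
  have := ((tendsto_omegaHomeo g tendsto_two_mul).add
    (tendsto_omegaHomeo g tendsto_two_mul_add_one)).div_const 2
  rwa [add_self_div_two] at this

/-- Even and odd terms share the limit `g ω`; this is what puts the inverse map into `H₁`. -/
theorem tendsto_halfDiff (g : C(OrdinalInterval Ordinal.omega0, ℝ)) :
    Tendsto (fun n : ℕ => (g (omegaHomeo ((2 * n : ℕ) : OnePoint ℕ)) -
      g (omegaHomeo ((2 * n + 1 : ℕ) : OnePoint ℕ))) / 2) atTop (𝓝 0) := by
  have := ((tendsto_omegaHomeo g tendsto_two_mul).sub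
    (tendsto_omegaHomeo g tendsto_two_mul_add_one)).div_const 2
  rwa [sub_self, zero_div] at this

/-- The inverse of `interleave`. -/
noncomputable def deinterleave (g : C(OrdinalInterval Ordinal.omega0, ℝ)) :
    C(OrdinalInterval (Ordinal.omega0 * 2), ℝ) :=
  (⟨Sum.elim (OnePoint.continuousMapMkNat _ _ (tendsto_halfSum g))
      (OnePoint.continuousMapMkNat _ _ (tendsto_halfDiff g)),
    (ContinuousMap.continuous _).sumElim (ContinuousMap.continuous _)⟩ :
      C(OnePoint ℕ ⊕ OnePoint ℕ, ℝ)).comp omegaTwoHomeo.symm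

theorem deinterleave_lowerSeq (g : C(OrdinalInterval Ordinal.omega0, ℝ)) (p : OnePoint ℕ) :
    deinterleave g (lowerSeq p) = OnePoint.continuousMapMkNat _ _ (tendsto_halfSum g) p := by
  change deinterleave g (omegaTwoHomeo (Sum.inl p)) = _
  simp only [deinterleave, ContinuousMap.comp_apply, ContinuousMap.coe_coe,
    Homeomorph.symm_apply_apply]
  rfl

theorem deinterleave_upperSeq (g : C(OrdinalInterval Ordinal.omega0, ℝ)) (p : OnePoint ℕ) :
    deinterleave g (upperSeq p) = OnePoint.continuousMapMkNat _ _ (tendsto_halfDiff g) p := by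
  change deinterleave g (omegaTwoHomeo (Sum.inr p)) = _
  simp only [deinterleave, ContinuousMap.comp_apply, ContinuousMap.coe_coe,
    Homeomorph.symm_apply_apply]
  rfl

theorem deinterleave_lowerSeq_coe (g : C(OrdinalInterval Ordinal.omega0, ℝ)) (n : ℕ) :
    deinterleave g (lowerSeq (n : OnePoint ℕ)) =
      (g (omegaHomeo ((2 * n : ℕ) : OnePoint ℕ)) +
        g (omegaHomeo ((2 * n + 1 : ℕ) : OnePoint ℕ))) / 2 :=
  deinterleave_lowerSeq g n

theorem deinterleave_lowerSeq_infty (g : C(OrdinalInterval Ordinal.omega0, ℝ)) :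
    deinterleave g (lowerSeq OnePoint.infty) = g (omegaHomeo OnePoint.infty) :=
  deinterleave_lowerSeq g OnePoint.infty

theorem deinterleave_upperSeq_coe (g : C(OrdinalInterval Ordinal.omega0, ℝ)) (n : ℕ) :
    deinterleave g (upperSeq (n : OnePoint ℕ)) =
      (g (omegaHomeo ((2 * n : ℕ) : OnePoint ℕ)) -
        g (omegaHomeo ((2 * n + 1 : ℕ) : OnePoint ℕ))) / 2 :=
  deinterleave_upperSeq g n

theorem deinterleave_upperSeq_infty (g : C(OrdinalInterval Ordinal.omega0, ℝ)) :
    deinterleave g (upperSeq OnePoint.infty) = 0 :=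
  deinterleave_upperSeq g OnePoint.infty

theorem deinterleave_mem (g : C(OrdinalInterval Ordinal.omega0, ℝ)) :
    deinterleave g ∈ exampleH₁ := by
  rw [mem_exampleH₁, ← upperSeq_infty, deinterleave_upperSeq_infty]

/-- Induction over the points `1, 2, …` and `ω`. -/
theorem forall_omega {P : OrdinalInterval Ordinal.omega0 → Prop}
    (h : ∀ n : ℕ, P (omegaHomeo (n : OnePoint ℕ))) (h' : P (omegaHomeo OnePoint.infty)) :
    ∀ x, P x := by
  intro x
  obtain ⟨p, rfl⟩ := omegaHomeo.surjective x
  induction p using OnePoint.rec with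
  | infty => exact h'
  | coe n => exact h n

/-- Induction over the points `1, 2, …`, `ω`, `ω + 1, ω + 2, …` and `ω·2`. -/
theorem forall_omega_mul_two {P : OrdinalInterval (Ordinal.omega0 * 2) → Prop}
    (h₁ : ∀ n : ℕ, P (lowerSeq (n : OnePoint ℕ))) (h₂ : P (lowerSeq OnePoint.infty))
    (h₃ : ∀ n : ℕ, P (upperSeq (n : OnePoint ℕ))) (h₄ : P (upperSeq OnePoint.infty)) :
    ∀ x, P x := by
  intro x
  obtain ⟨p | p, rfl⟩ := lowerSeq_sumElim_upperSeq_bijective.2 x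
  · induction p using OnePoint.rec with
    | infty => exact h₂
    | coe n => exact h₁ n
  · induction p using OnePoint.rec with
    | infty => exact h₄
    | coe n => exact h₃ n

/-- The linear isomorphism `f ↦ interleave f`. -/
noncomputable def interleaveLinearEquiv : exampleH₁ ≃ₗ[ℝ] exampleH₂ where
  toFun f := ⟨interleave f, Submodule.mem_top⟩
  map_add' f g := by
    refine Subtype.ext (ContinuousMap.ext (forall_omega (fun n => ?_) ?_))
    · change interleave _ _ = interleave _ _ + interleave _ _
      simp only [interleave_coe, Submodule.coe_add, ContinuousMap.add_apply]
      ring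
    · change interleave _ _ = interleave _ _ + interleave _ _
      simp only [interleave_infty, Submodule.coe_add, ContinuousMap.add_apply]
  map_smul' c f := by
    refine Subtype.ext (ContinuousMap.ext (forall_omega (fun n => ?_) ?_))
    · change interleave _ _ = c * interleave _ _
      simp only [interleave_coe, Submodule.coe_smul, ContinuousMap.smul_apply, smul_eq_mul]
      ring
    · change interleave _ _ = c * interleave _ _
      simp only [interleave_infty, Submodule.coe_smul, ContinuousMap.smul_apply, smul_eq_mul]
  invFun g := ⟨deinterleave g, deinterleave_mem g⟩
  left_inv f := by
    refine Subtype.ext (ContinuousMap.ext (forall_omega_mul_two (fun n => ?_) ?_ (fun n => ?_) ?_))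
    · change deinterleave (interleave f) _ = _
      have h1 : (2 * n + 1) / 2 = n := by omega
      have h2 : 2 * n / 2 = n := by omega
      rw [deinterleave_lowerSeq_coe, interleave_coe, interleave_coe, h1, h2, pow_succ, pow_mul]
      norm_num
      ring
    · change deinterleave (interleave f) _ = _
      rw [deinterleave_lowerSeq_infty, interleave_infty]
    · change deinterleave (interleave f) _ = _
      have h1 : (2 * n + 1) / 2 = n := by omega
      have h2 : 2 * n / 2 = n := by omega
      rw [deinterleave_upperSeq_coe, interleave_coe, interleave_coe, h1, h2, pow_succ, pow_mul]
      norm_num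
    · change deinterleave (interleave f) _ = _
      rw [deinterleave_upperSeq_infty, upperSeq_infty]
      exact f.2.symm
  right_inv g := by
    refine Subtype.ext (ContinuousMap.ext (forall_omega (fun n => ?_) ?_))
    · change interleave ⟨deinterleave g, _⟩ _ = _
      rw [interleave_coe]
      simp only [deinterleave_lowerSeq_coe, deinterleave_upperSeq_coe]
      rcases Nat.even_or_odd' n with ⟨k, rfl | rfl⟩
      · rw [show 2 * k / 2 = k by omega, pow_mul]
        norm_num
        ring
      · rw [show (2 * k + 1) / 2 = k by omega, pow_succ, pow_mul]
        norm_num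
        ring
    · change interleave ⟨deinterleave g, _⟩ _ = _
      rw [interleave_infty]
      exact deinterleave_lowerSeq_infty _

theorem norm_interleaveLinearEquiv_le (f : exampleH₁) : ‖interleaveLinearEquiv f‖ ≤ 2 * ‖f‖ := by
  have hf := (f : C(OrdinalInterval (Ordinal.omega0 * 2), ℝ)).norm_coe_le_norm
  refine (ContinuousMap.norm_le _ (by positivity)).2 (forall_omega (fun n => ?_) ?_)
  · change ‖interleave f _‖ ≤ _
    rw [interleave_coe, two_mul]
    refine (norm_add_le _ _).trans (add_le_add (hf _) ?_)
    simpa [norm_mul] using hf (upperSeq ((n / 2 : ℕ) : OnePoint ℕ))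
  · change ‖interleave f _‖ ≤ _
    rw [interleave_infty, two_mul]
    exact (hf _).trans (le_add_of_nonneg_right (norm_nonneg f))

theorem norm_interleaveLinearEquiv_symm_le (g : exampleH₂) :
    ‖interleaveLinearEquiv.symm g‖ ≤ 1 * ‖g‖ := by
  have hg := fun x => (g : C(OrdinalInterval Ordinal.omega0, ℝ)).norm_coe_le_norm x
  rw [one_mul]
  have half : ∀ a b : ℝ, ‖a‖ ≤ ‖g‖ → ‖b‖ ≤ ‖g‖ → ‖(a + b) / 2‖ ≤ ‖g‖ := by
    intro a b ha hb
    rw [norm_div, Real.norm_two]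
    linarith [norm_add_le a b]
  refine (ContinuousMap.norm_le _ (norm_nonneg _)).2
    (forall_omega_mul_two (fun n => ?_) ?_ (fun n => ?_) ?_)
  · change ‖deinterleave g _‖ ≤ _
    rw [deinterleave_lowerSeq_coe]
    exact half _ _ (hg _) (hg _)
  · change ‖deinterleave g _‖ ≤ _
    rw [deinterleave_lowerSeq_infty]
    exact hg _
  · change ‖deinterleave g _‖ ≤ _
    rw [deinterleave_upperSeq_coe, sub_eq_add_neg]
    exact half _ _ (hg _) ((norm_neg _).trans_le (hg _))
  · change ‖deinterleave g _‖ ≤ _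
    rw [deinterleave_upperSeq_infty, norm_zero]
    exact norm_nonneg _

theorem exists_equiv_norm_mul_norm_symm_le_two : ∃ T : exampleH₁ ≃L[ℝ] exampleH₂,
    ‖(T : exampleH₁ →L[ℝ] exampleH₂)‖ * ‖(T.symm : exampleH₂ →L[ℝ] exampleH₁)‖ ≤ 2 := by
  refine ⟨interleaveLinearEquiv.toContinuousLinearEquivOfBounds 2 1
    norm_interleaveLinearEquiv_le norm_interleaveLinearEquiv_symm_le, ?_⟩
  refine le_of_le_of_eq (mul_le_mul
    (ContinuousLinearMap.opNorm_le_bound _ zero_le_two norm_interleaveLinearEquiv_le)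
    (ContinuousLinearMap.opNorm_le_bound _ zero_le_one norm_interleaveLinearEquiv_symm_le)
    (norm_nonneg _) zero_le_two) (mul_one 2)

/-! ### The lower bound for the distortion -/

/-- Every `f ∈ H₁` admits a unit vector almost disjoint from it. -/
theorem exists_norm_add_smul_le (f : exampleH₁) {ε : ℝ} (hε : 0 < ε) :
    ∃ e : exampleH₁, ‖e‖ = 1 ∧ ∀ c : ℝ, ‖f + c • e‖ ≤ max ‖f‖ (|c| + ε) := by
  have hev := (upperSeq_tendsto_zero f).abs
  rw [abs_zero] at hev
  -- Far out in the upper half `f` is below `ε`; the bump `e` is placed at such an isolated-from-`f`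
  -- point and supported where `|f| < ε`.
  obtain ⟨n, hn⟩ := (hev.eventually_lt_const hε).exists
  have hU : {y | |(f : C(OrdinalInterval (Ordinal.omega0 * 2), ℝ)) y| < ε} ∈
      𝓝 (upperSeq (n : OnePoint ℕ)) :=
    (isOpen_lt (f : C(OrdinalInterval (Ordinal.omega0 * 2), ℝ)).continuous.abs
      continuous_const).mem_nhds hn
  obtain ⟨h, hh, h01, h1, h0⟩ := hasIndicatorBasis_exampleH₁ (upperSeq_coe_ne_top n) _ hU
  refine ⟨⟨h, hh⟩, le_antisymm ?_ ?_, fun c => ?_⟩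
  · exact (ContinuousMap.norm_le _ zero_le_one).2 fun y =>
      (Real.norm_of_nonneg (h01 y).1).trans_le (h01 y).2
  · have := h.norm_coe_le_norm (upperSeq (n : OnePoint ℕ))
    rwa [h1, norm_one] at this
  · refine (ContinuousMap.norm_le _ ((norm_nonneg f).trans (le_max_left _ _))).2 fun y => ?_
    change |(f : C(OrdinalInterval (Ordinal.omega0 * 2), ℝ)) y + c * h y| ≤ _
    by_cases hy : |(f : C(OrdinalInterval (Ordinal.omega0 * 2), ℝ)) y| < ε
    · refine (abs_add_le _ _).trans (le_max_of_le_right ?_)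
      rw [abs_mul, abs_of_nonneg (h01 y).1]
      have := mul_le_mul_of_nonneg_left (h01 y).2 (abs_nonneg c)
      linarith
    · rw [h0 y hy, mul_zero, add_zero]
      exact le_max_of_le_left
        ((f : C(OrdinalInterval (Ordinal.omega0 * 2), ℝ)).norm_coe_le_norm y)

/-- In `C(K)`, the constant function `1` is at distance `1 + ‖g‖` from `g` or from `-g`. -/
theorem one_add_norm_le_max {K : Type*} [TopologicalSpace K] [CompactSpace K] [Nonempty K]
    (g : C(K, ℝ)) : 1 + ‖g‖ ≤ max ‖1 + g‖ ‖1 - g‖ := by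
  obtain ⟨x, hx⟩ : ∃ x, ‖g‖ = ‖g x‖ := by
    obtain ⟨x, -, hx⟩ := isCompact_univ.exists_isMaxOn univ_nonempty g.continuous.norm.continuousOn
    refine ⟨x, le_antisymm ((ContinuousMap.norm_le _ (norm_nonneg _)).2 fun y => hx (mem_univ y))
      (g.norm_coe_le_norm x)⟩
  rw [hx]
  rcases le_total 0 (g x) with h | h
  · refine le_max_of_le_left (le_trans ?_ ((1 + g).norm_coe_le_norm x))
    rw [Real.norm_of_nonneg h]
    exact le_abs_self (1 + g x)
  · refine le_max_of_le_right (le_trans ?_ ((1 - g).norm_coe_le_norm x))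
    rw [Real.norm_of_nonpos h, ← sub_eq_add_neg]
    exact le_abs_self (1 - g x)

/-- Take a unit `e` nearly disjoint from `T⁻¹ 1`. Then `T⁻¹ 1 ± N e` has norm at most `N + ε`, so `1
± N T e` has norm at most `M (N + ε)`. One of these two norms is at least `1 + N ‖T e‖ ≥ 2`; let `ε
→ 0`. -/
theorem two_le_norm_mul_norm_symm (T : exampleH₁ ≃L[ℝ] exampleH₂) :
    2 ≤ ‖(T : exampleH₁ →L[ℝ] exampleH₂)‖ * ‖(T.symm : exampleH₂ →L[ℝ] exampleH₁)‖ := by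
  set M := ‖(T : exampleH₁ →L[ℝ] exampleH₂)‖
  set N := ‖(T.symm : exampleH₂ →L[ℝ] exampleH₁)‖
  have : Nonempty (OrdinalInterval Ordinal.omega0) := ⟨omegaHomeo OnePoint.infty⟩
  have hM : 0 ≤ M := norm_nonneg _
  have hN : 0 ≤ N := norm_nonneg _
  have key : ∀ ε : ℝ, 0 < ε → 2 ≤ M * (N + ε) := by
    intro ε hε
    let u : exampleH₂ := ⟨1, Submodule.mem_top⟩
    have hu : ‖u‖ = 1 := norm_one (α := C(OrdinalInterval Ordinal.omega0, ℝ))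
    have hf : ‖T.symm u‖ ≤ N := by
      have := (T.symm : exampleH₂ →L[ℝ] exampleH₁).le_opNorm u
      rwa [hu, mul_one] at this
    obtain ⟨e, he, hfe⟩ := exists_norm_add_smul_le (T.symm u) hε
    -- The scale `N` is the largest that keeps the perturbation of `T.symm u` within `N + ε`, and it
    -- suffices here because `1 = ‖e‖ ≤ N ‖T e‖`.
    have hTe : 1 ≤ ‖N • T e‖ := by
      have := (T.symm : exampleH₂ →L[ℝ] exampleH₁).le_opNorm (T e)
      rw [norm_smul, Real.norm_of_nonneg hN]
      have h2 : (T.symm : exampleH₂ →L[ℝ] exampleH₁) (T e) = e := T.symm_apply_apply e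
      rwa [h2, he] at this
    have hbound : ∀ c : ℝ, |c| = N → ‖u + c • T e‖ ≤ M * (N + ε) := by
      intro c hc
      have h1 := (T : exampleH₁ →L[ℝ] exampleH₂).le_opNorm (T.symm u + c • e)
      have h2 : (T : exampleH₁ →L[ℝ] exampleH₂) (T.symm u + c • e) = u + c • T e := by
        change T (T.symm u + c • e) = _
        rw [map_add, map_smul, T.apply_symm_apply]
      rw [h2] at h1
      refine h1.trans (mul_le_mul_of_nonneg_left ((hfe c).trans (max_le ?_ ?_)) hM)
      · linarith
      · rw [hc]
    have h3 : 1 + ‖N • T e‖ ≤ max ‖u + N • T e‖ ‖u - N • T e‖ :=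
      one_add_norm_le_max ((N • T e : exampleH₂) : C(OrdinalInterval Ordinal.omega0, ℝ))
    have h4 := hbound N (abs_of_nonneg hN)
    have h5 := hbound (-N) (by rw [abs_neg, abs_of_nonneg hN])
    rw [neg_smul, ← sub_eq_add_neg] at h5
    linarith [h3.trans (max_le h4 h5)]
  have hlim : Tendsto (fun ε : ℝ => M * (N + ε)) (𝓝[>] 0) (𝓝 (M * (N + 0))) :=
    ((continuous_const.mul (continuous_const.add continuous_id)).tendsto 0).mono_left
      nhdsWithin_le_nhds
  rw [add_zero] at hlim
  exact ge_of_tendsto hlim (eventually_mem_nhdsWithin.mono fun ε hε => key ε hε)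

theorem banachMazurDist_example : banachMazurDist exampleH₁ exampleH₂ = 2 := by
  apply le_antisymm
  · obtain ⟨T, hT⟩ := exists_equiv_norm_mul_norm_symm_le_two
    refine (iInf_le _ T).trans ((ENNReal.ofReal_le_ofReal hT).trans ?_)
    simp
  · refine le_iInf fun T => ?_
    rw [← ENNReal.ofReal_ofNat 2]
    exact ENNReal.ofReal_le_ofReal (two_le_norm_mul_norm_symm T)

/-! ### Copies of `c₀` and of powers in finite dimension -/

/-- A finitely supported sequence, as an element of `c₀`. -/
noncomputable def unitVecC₀ (k : ℕ) : C₀(ℕ, ℝ) where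
  toFun := Pi.single k 1
  continuous_toFun := continuous_of_discreteTopology
  zero_at_infty' := by
    rw [cocompact_eq_cofinite, Nat.cofinite_eq_atTop]
    refine tendsto_const_nhds.congr' ?_
    filter_upwards [eventually_gt_atTop k] with n hn
    exact (Pi.single_eq_of_ne (M := fun _ : ℕ => ℝ) hn.ne' 1).symm

theorem not_containsCopy_real_c₀ : ¬ ContainsCopy ℝ C₀(ℕ, ℝ) := by
  rintro ⟨S, ⟨e⟩⟩
  -- Any two vectors with images in `ℝ` are dependent; reading coordinate 1 of this relation kills
  -- the image of `unitVecC₀ 0`.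
  have hrel : (e (unitVecC₀ 1) : ℝ) • unitVecC₀ 0 = (e (unitVecC₀ 0) : ℝ) • unitVecC₀ 1 := by
    apply e.injective
    apply Subtype.ext
    rw [map_smul, map_smul, Submodule.coe_smul, Submodule.coe_smul, smul_eq_mul, smul_eq_mul,
      mul_comm]
  have h0 := congrArg (fun f : C₀(ℕ, ℝ) => f 1) hrel
  have h1 : (e (unitVecC₀ 0) : ℝ) = 0 := by
    simpa [unitVecC₀] using h0.symm
  have h2 : unitVecC₀ 0 = 0 := e.injective (by rw [map_zero]; exact Subtype.ext h1)
  have h3 := congrArg (fun f : C₀(ℕ, ℝ) => f 0) h2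
  simp [unitVecC₀] at h3

theorem not_containsCopy_real_pow {m n : ℕ} (h : m < n) :
    ¬ ContainsCopy (Fin m → ℝ) (Fin n → ℝ) := by
  rintro ⟨S, ⟨e⟩⟩
  have h1 := e.toLinearEquiv.finrank_eq
  have h2 := S.finrank_le
  rw [← h1, Module.finrank_fin_fun, Module.finrank_fin_fun] at h2
  omega

theorem rigidityHypotheses_example : RigidityHypotheses exampleH₁ exampleH₂ := by
  obtain ⟨T, hT⟩ := exists_equiv_norm_mul_norm_symm_le_two
  refine ⟨inferInstance, inferInstance, not_containsCopy_real_c₀, not_containsCopy_real_c₀,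
    fun m n h => ⟨not_containsCopy_real_pow h, not_containsCopy_real_pow h⟩,
    inferInstance, inferInstance, isClosed_exampleH₁, isClosed_exampleH₂,
    to_countable _, to_countable _, fun x hx => ?_, fun x _ => ?_, T, by linarith⟩
  · rw [choquetBoundary_exampleH₁] at hx
    exact (hasIndicatorBasis_exampleH₁ hx).isWeakPeakPoint isClosed_exampleH₁
  · exact (hasIndicatorBasis_exampleH₂ x).isWeakPeakPoint isClosed_exampleH₂

/-- The compact spaces range over `Type 1` because that is where intervals of `Ordinal.{0}` live. -/
theorem mainTheorem6 :
    -- both Choquet boundaries are countable and consist of weak peak points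
    ((choquetBoundary exampleH₁).Countable ∧ (choquetBoundary exampleH₂).Countable ∧
      (∀ x ∈ choquetBoundary exampleH₁, IsWeakPeakPoint exampleH₁ x) ∧
      (∀ x ∈ choquetBoundary exampleH₂, IsWeakPeakPoint exampleH₂ x)) ∧
    -- the Banach-Mazur distance
    banachMazurDist exampleH₁ exampleH₂ = 2 ∧
    -- the pair is a counterexample in which one of the boundaries is not closed
    (RigidityHypotheses exampleH₁ exampleH₂ ∧
      ¬ IsClosed (choquetBoundary exampleH₁) ∧ IsClosed (choquetBoundary exampleH₂) ∧
      IsEmpty (choquetBoundary exampleH₁ ≃ₜ choquetBoundary exampleH₂)) ∧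
    -- so the theorem fails without closedness
    ¬ (∀ (K₁ K₂ : Type 1) (E₁ E₂ : Type)
        [TopologicalSpace K₁] [CompactSpace K₁] [T2Space K₁]
        [TopologicalSpace K₂] [CompactSpace K₂] [T2Space K₂]
        [NormedAddCommGroup E₁] [NormedSpace ℝ E₁] [CompleteSpace E₁]
        [NormedAddCommGroup E₂] [NormedSpace ℝ E₂] [CompleteSpace E₂]
        (H₁ : Submodule ℝ C(K₁, E₁)) (H₂ : Submodule ℝ C(K₂, E₂)),
        RigidityHypotheses H₁ H₂ →
          Nonempty (choquetBoundary H₁ ≃ₜ choquetBoundary H₂)) := by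
  obtain ⟨-, -, -, -, -, -, -, -, -, hc₁, hc₂, hw₁, hw₂, -⟩ := rigidityHypotheses_example
  refine ⟨⟨hc₁, hc₂, hw₁, hw₂⟩, banachMazurDist_example,
    ⟨rigidityHypotheses_example, not_isClosed_choquetBoundary_exampleH₁, ?_,
      isEmpty_choquetBoundary_homeomorph⟩, fun h => ?_⟩
  · rw [choquetBoundary_exampleH₂]
    exact isClosed_univ
  · obtain ⟨e⟩ := h _ _ ℝ ℝ exampleH₁ exampleH₂ rigidityHypotheses_example
    exact isEmpty_choquetBoundary_homeomorph.false e
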